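/- **Problem.** Let $N,n\ge 0$. Consider the linear least-squares problem in the trajectory $\chi=(X_0,\dots,X_N)$, $X_k\in\mathbb R^n$, given by * a prior $z_0\in\mathbb R^n$ on $X_0$ with covariance $P_0$; * for $0\le k<N$, the dynamics $X_{k+1}=F_kX_k+u_k+w_k$, where $w_k$ has covariance $Q_k$; * for $1\le k\le N$, an observation $Z_k=H_kX_k+\sum_{l\in L_k}H_{k,l}X_l+V_k\in\mathbb R^{p_k}$, where $L_k\subseteq\{0,\dots,k-1\}$ and $V_k$ has covariance $R_k$. ($L_k=\emptyset$: unary observation; $L_k=\{l\}$: relative observation of the pair $(l,k)$; several simultaneous observations are stacked; $p_k=0$: no observation.) With $\|e\|_P^2=e^TP^{-1}e$ its cost is $$\bar L(\chi)=\|X_0-z_0\|^2_{P_0}+\sum_{k=0}^{N-1}\|X_{k+1}-F_kX_k-u_k\|^2_{Q_k}+\sum_{k=1}^{N}\Big\|H_kX_k+\sum_{l\in L_k}H_{k,l}X_l-Z_k\Big\|^2_{R_k}.$$ (The linearized cost of a Gauss–Newton step is of this form, $X_k$ being then the increment $\delta X_k$.) If $P$ is singular and positive semidefinite, put $\|e\|_P^2=v^TPv$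 when $e=Pv$, and $\|e\|_P^2=+\infty$ when $e\notin\operatorname{range}P$, so that null directions are hard constraints. **Augmented system (stochastic cloning).** Let $S_k$ be the set of all $i<k$ such that $i\in L_m$ for some $k\le m\le N$, let $I_k=\{k\}\cup S_k$ and $\tilde X_k=(X_i)_{i\in I_k}$, with block $X_k$ first. Let $D_k$ be the identity matrix without the rows of the blocks $i\in S_k\setminus S_{k+1}$ (discarding); let $C_k$ be the matrix that appends a copy of the block $X_k$ (as clone $k$) if $k\in S_{k+1}$, and the identity otherwise (cloning). Put $$F_k^p=\begin{pmatrix}F_k&0\\0&I\end{pmatrix},\quad \tilde F_k=F_k^pC_kD_k,\quad \tilde u_k=\begin{pmatrix}u_k\\0\end{pmatrix},\quad \tilde Q_k=\begin{pmatrix}Q_k&0\\0&0\end{pmatrix},$$ and let $\tilde H_k$ be given by $\tilde H_k\tilde X_k=H_kX_k+\sum_{l\in L_k}H_{k,l}X_l$. **Algorithm SC-BIFM.** * *Forward pass.* $\tilde x_0=z_0$, $\tilde P_0=P_0$. For $k<N$, with $x^-=\tilde F_k\tilde x_k+\tilde u_k$, $P^-=\tilde F_k\tilde P_k\tilde F_k^T+\tilde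 Q_k$, $\Sigma_{k+1}=\tilde H_{k+1}P^-\tilde H_{k+1}^T+R_{k+1}$ and $K=P^-\tilde H_{k+1}^T\Sigma_{k+1}^{-1}$, set $\tilde x_{k+1}=x^-+K(Z_{k+1}-\tilde H_{k+1}x^-)$ and $\tilde P_{k+1}=P^--K\tilde H_{k+1}P^-$. * *Backward pass.* $\tilde y_N=0$, $\tilde J_N=0$. For $k=N-1,\dots,0$, with $J^+_{k+1}=\tilde J_{k+1}+\tilde H_{k+1}^TR_{k+1}^{-1}\tilde H_{k+1}$ and $y^+_{k+1}=\tilde y_{k+1}+\tilde H_{k+1}^TR_{k+1}^{-1}Z_{k+1}$, set $\tilde J_k=\tilde F_k^T(I+J^+_{k+1}\tilde Q_k)^{-1}J^+_{k+1}\tilde F_k$ and $\tilde y_k=\tilde F_k^T(I+J^+_{k+1}\tilde Q_k)^{-1}(y^+_{k+1}-J^+_{k+1}\tilde u_k)$. * *Fusion.* For $0\le k\le N$, $\tilde X_k^*=(I+\tilde P_k\tilde J_k)^{-1}(\tilde x_k+\tilde P_k\tilde y_k)$. The output is $\chi^*=(X_0^*,\dots,X_N^*)$, where $X^*_k$ is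 the block of $\tilde X^*_k$ belonging to the current state $k$. **Claim.** Let $P_0$ and all $Q_k$ be symmetric positive semidefinite, possibly singular or zero, and let all $R_k$ be symmetric positive definite. Then: 1. (*No inversion of $P_0$, $Q_k$ or $\tilde P_k$.*) The only matrices that the procedure inverts are $\Sigma_{k+1}$, $R_{k+1}$ and $I+J^+_{k+1}\tilde Q_k$ for $k<N$, and $I+\tilde P_k\tilde J_k$ for $k\le N$, and all of them are invertible. 2. (*Clone merging.*) Let $k<N$, and let $y'=(F_k^p)^T(I+J^+_{k+1}\tilde Q_k)^{-1}(y^+_{k+1}-J^+_{k+1}\tilde u_k)$ and $J'=(F_k^p)^T(I+J^+_{k+1}\tilde Q_k)^{-1}J^+_{k+1}F_k^p$. If $k\in S_{k+1}$, then, writing $c$ for the first (current-state) block and $l$ for the block of clone $k$ in $y',J'$, the current-state blocks of $\tilde y_k$ and $\tilde J_k$ are $y'_c+y'_l$ and $J'_{cc}+J'_{cl}+J'_{lc}+J'_{ll}$. The blocks of $\tilde y_k$ and $\tilde J_k$ that belong to the clones in $S_k\setminus S_{k+1}$ are zero. 3. (*Exactness.*) If $P_0$ and all $Q_k$ are positive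 definite, then $\chi^*$ is the unique minimizer of $\bar L$. If $P_0$ and the $Q_k$ are only positive semidefinite, then $\bar L(\chi^*)<\infty$ and $\chi^*$ is the unique minimizer of $\bar L$ in the extended sense above. -/

import Mathlib

open scoped Matrix ENNReal

noncomputable section

/-- The squared Mahalanobis norm `‖e‖²_P = eᵀ P⁻¹ e`, for an invertible covariance `P`. -/
def mahalanobisSq {ι : Type*} [Fintype ι] [DecidableEq ι] (P : Matrix ι ι ℝ) (e : ι → ℝ) : ℝ :=
  e ⬝ᵥ (P⁻¹ *ᵥ e)

/-- The squared Mahalanobis norm for a possibly singular covariance `P`, the null directions of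
`P` being hard constraints: its value is `vᵀ P v` if `e = P v` (this does not depend on `v` when
`P` is symmetric), and `∞` if `e` is not in the range of `P`. -/
def mahalanobisSqExt {ι : Type*} [Fintype ι] (P : Matrix ι ι ℝ) (e : ι → ℝ) : ℝ≥0∞ :=
  ⨅ v : {v : ι → ℝ // P *ᵥ v = e}, ENNReal.ofReal (v.1 ⬝ᵥ (P *ᵥ v.1))

/-- The data of a linear least-squares smoothing problem over the times `0, …, N`:
* prior: `X₀ ≈ z0`, with covariance `P0`;
* dynamics, for `k < N`: `X (k+1) = F k X k + u k + w k`, where `w k` has covariance `Q k`;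
* observations, for `1 ≤ k ≤ N`: `z k = H k X k + ∑ l ∈ L k, Hpast k l X l + V k`, where `V k` has
  covariance `R k`.

`L k` is the set of the past times `l < k` that are involved in the observation made at time `k`:
it is empty for a unary observation and is `{l}` for a relative observation of the pair `(l, k)`;
several observations made at the same time are stacked in one vector, and the absence of any
observation is `p k = 0`. Only the entries with the indices shown above are ever used. -/
structure SmoothingProblem where
  /-- last time index -/
  N : ℕ
  /-- dimension of the states -/
  n : ℕ
  /-- dimensions of the observations -/
  p : ℕ → ℕ
  z0 : Fin n → ℝ
  P0 : Matrix (Fin n) (Fin n) ℝ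
  F : ℕ → Matrix (Fin n) (Fin n) ℝ
  u : ℕ → Fin n → ℝ
  Q : ℕ → Matrix (Fin n) (Fin n) ℝ
  L : (k : ℕ) → Finset (Fin k)
  H : (k : ℕ) → Matrix (Fin (p k)) (Fin n) ℝ
  Hpast : (k : ℕ) → Fin k → Matrix (Fin (p k)) (Fin n) ℝ
  z : (k : ℕ) → Fin (p k) → ℝ
  R : (k : ℕ) → Matrix (Fin (p k)) (Fin (p k)) ℝ

namespace SmoothingProblem

variable (M : SmoothingProblem)

/-! ### The least-squares cost -/

/-- A trajectory `χ = (X₀, …, X_N)`. -/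
abbrev Trajectory : Type := Fin (M.N + 1) → Fin M.n → ℝ

/-- Residual of the dynamics between the times `k` and `k + 1`. -/
def dynResidual (χ : M.Trajectory) (k : Fin M.N) : Fin M.n → ℝ :=
  χ k.succ - M.F k *ᵥ χ k.castSucc - M.u k

/-- Residual of the observation made at time `k + 1`. -/
def obsResidual (χ : M.Trajectory) (k : Fin M.N) : Fin (M.p (k + 1)) → ℝ :=
  M.H (k + 1) *ᵥ χ k.succ
    + ∑ l ∈ M.L (k + 1), M.Hpast (k + 1) l *ᵥ χ (l.castLE (by omega)) - M.z (k + 1)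

/-- The least-squares cost, for invertible covariances. -/
def cost (χ : M.Trajectory) : ℝ :=
  mahalanobisSq M.P0 (χ 0 - M.z0)
    + ∑ k : Fin M.N, mahalanobisSq (M.Q k) (M.dynResidual χ k)
    + ∑ k : Fin M.N, mahalanobisSq (M.R (k + 1)) (M.obsResidual χ k)

/-- The least-squares cost, for possibly singular covariances. -/
def costExt (χ : M.Trajectory) : ℝ≥0∞ :=
  mahalanobisSqExt M.P0 (χ 0 - M.z0)
    + ∑ k : Fin M.N, mahalanobisSqExt (M.Q k) (M.dynResidual χ k)
    + ∑ k : Fin M.N, mahalanobisSqExt (M.R (k + 1)) (M.obsResidual χ k)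

/-! ### The augmented system of stochastic cloning -/

/-- The clones present at time `k`: the past times that are involved in an observation made at
time `k` or later. The index set of the augmented state at time `k` is `{k} ∪ clones k`. -/
def clones (k : ℕ) : Finset ℕ :=
  (Finset.range k).filter fun i => ∃ m ∈ Finset.Icc k M.N, ∃ l ∈ M.L m, (l : ℕ) = i

theorem lt_of_mem_clones {k i : ℕ} (h : i ∈ M.clones k) : i < k :=
  Finset.mem_range.1 (Finset.mem_filter.1 h).1

theorem mem_kept {k i : ℕ} (h : i ∈ M.clones (k + 1)) (hi : i ≠ k) :
    i ∈ M.clones k ∩ M.clones (k + 1) := by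
  refine Finset.mem_inter.2 ⟨?_, h⟩
  have h0 := M.lt_of_mem_clones h
  obtain ⟨m, hm, hl⟩ := (Finset.mem_filter.1 h).2
  refine Finset.mem_filter.2 ⟨Finset.mem_range.2 (by omega), m, ?_, hl⟩
  rw [Finset.mem_Icc] at hm ⊢
  omega

/-- Coordinates of the augmented state at time `k`: those of the current state (`Sum.inl`), then
those of the clones (`Sum.inr`). -/
abbrev Aug (k : ℕ) : Type := Fin M.n ⊕ ({i // i ∈ M.clones k} × Fin M.n)

/-- Coordinates of the augmented state at time `k` after the discarding of the clones that are not
present at time `k + 1`. -/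
abbrev Kept (k : ℕ) : Type := Fin M.n ⊕ ({i // i ∈ M.clones k ∩ M.clones (k + 1)} × Fin M.n)

/-- Discarding matrix: the identity matrix without the rows of the discarded clones. -/
def discard (k : ℕ) : Matrix (M.Kept k) (M.Aug k) ℝ :=
  (1 : Matrix (M.Aug k) (M.Aug k) ℝ).submatrix
    (fun r => match r with
      | Sum.inl a => Sum.inl a
      | Sum.inr (i, a) => Sum.inr (⟨i.1, (Finset.mem_inter.1 i.2).1⟩, a))
    id

/-- Cloning matrix: the identity matrix, in which the rows of the current state are repeated as
those of the clone `k` if `k` is a clone at time `k + 1`. -/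
def duplicate (k : ℕ) : Matrix (M.Aug (k + 1)) (M.Kept k) ℝ :=
  (1 : Matrix (M.Kept k) (M.Kept k) ℝ).submatrix
    (fun r => match r with
      | Sum.inl a => Sum.inl a
      | Sum.inr (i, a) =>
          if h : i.1 = k then Sum.inl a else Sum.inr (⟨i.1, M.mem_kept i.2 h⟩, a))
    id

/-- Propagation matrix: the clones are static. -/
def Fprop (k : ℕ) : Matrix (M.Aug (k + 1)) (M.Aug (k + 1)) ℝ :=
  Matrix.fromBlocks (M.F k) 0 0 1

/-- Transition matrix of the augmented system (discarding, then cloning, then propagation). -/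
def Faug (k : ℕ) : Matrix (M.Aug (k + 1)) (M.Aug k) ℝ :=
  M.Fprop k * M.duplicate k * M.discard k

/-- Input of the augmented system. -/
def uaug (k : ℕ) : M.Aug (k + 1) → ℝ := Sum.elim (M.u k) 0

/-- Process noise covariance of the augmented system. -/
def Qaug (k : ℕ) : Matrix (M.Aug (k + 1)) (M.Aug (k + 1)) ℝ :=
  Matrix.fromBlocks (M.Q k) 0 0 0

/-- Observation matrix of the augmented system. -/
def Haug (k : ℕ) : Matrix (Fin (M.p k)) (M.Aug k) ℝ :=
  Matrix.fromCols (M.H k) (Matrix.of fun r c =>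
    if (⟨c.1.1, M.lt_of_mem_clones c.1.2⟩ : Fin k) ∈ M.L k then
      M.Hpast k ⟨c.1.1, M.lt_of_mem_clones c.1.2⟩ r c.2
    else 0)

/-! ### Forward pass: Kalman filter on the augmented system -/

/-- Predicted mean at time `k + 1` from the filtered mean at time `k`. -/
def predMean (k : ℕ) (x : M.Aug k → ℝ) : M.Aug (k + 1) → ℝ :=
  M.Faug k *ᵥ x + M.uaug k

/-- Predicted covariance at time `k + 1` from the filtered covariance at time `k`. -/
def predCov (k : ℕ) (P : Matrix (M.Aug k) (M.Aug k) ℝ) :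
    Matrix (M.Aug (k + 1)) (M.Aug (k + 1)) ℝ :=
  M.Faug k * P * (M.Faug k)ᵀ + M.Qaug k

/-- Innovation covariance at time `k` for the predicted covariance `P`. -/
def innovCov (k : ℕ) (P : Matrix (M.Aug k) (M.Aug k) ℝ) : Matrix (Fin (M.p k)) (Fin (M.p k)) ℝ :=
  M.Haug k * P * (M.Haug k)ᵀ + M.R k

/-- Kalman gain at time `k` for the predicted covariance `P`. -/
def gain (k : ℕ) (P : Matrix (M.Aug k) (M.Aug k) ℝ) : Matrix (M.Aug k) (Fin (M.p k)) ℝ :=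
  P * (M.Haug k)ᵀ * (M.innovCov k P)⁻¹

/-- The forward pass: mean and covariance of the augmented state at time `k`, given the prior and
the observations made at the times `1, …, k`. -/
def forward : (k : ℕ) → (M.Aug k → ℝ) × Matrix (M.Aug k) (M.Aug k) ℝ
  | 0 => (Sum.elim M.z0 0, Matrix.fromBlocks M.P0 0 0 0)
  | k + 1 =>
    let x := M.predMean k (forward k).1
    let P := M.predCov k (forward k).2
    (x + M.gain (k + 1) P *ᵥ (M.z (k + 1) - M.Haug (k + 1) *ᵥ x),
      P - M.gain (k + 1) P * M.Haug (k + 1) * P)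

/-! ### Backward pass: information filter on the augmented system -/

/-- Update of the information vector with the observation made at time `k`. -/
def updVec (k : ℕ) (y : M.Aug k → ℝ) : M.Aug k → ℝ :=
  y + (M.Haug k)ᵀ *ᵥ ((M.R k)⁻¹ *ᵥ M.z k)

/-- Update of the information matrix with the observation made at time `k`. -/
def updMat (k : ℕ) (J : Matrix (M.Aug k) (M.Aug k) ℝ) : Matrix (M.Aug k) (M.Aug k) ℝ :=
  J + (M.Haug k)ᵀ * (M.R k)⁻¹ * M.Haug k

/-- The backward pass: information vector and matrix about the augmented state at time `k`, given
the observations made at the times `k + 1, …, N`. -/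
def backward (k : ℕ) : (M.Aug k → ℝ) × Matrix (M.Aug k) (M.Aug k) ℝ :=
  if k < M.N then
    let y := M.updVec (k + 1) (backward (k + 1)).1
    let J := M.updMat (k + 1) (backward (k + 1)).2
    ((M.Faug k)ᵀ *ᵥ ((1 + J * M.Qaug k)⁻¹ *ᵥ (y - J *ᵥ M.uaug k)),
      (M.Faug k)ᵀ * (1 + J * M.Qaug k)⁻¹ * J * M.Faug k)
  else (0, 0)
termination_by M.N - k

/-- Updated information matrix at time `k`. -/
def updatedJ (k : ℕ) : Matrix (M.Aug k) (M.Aug k) ℝ := M.updMat k (M.backward k).2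

/-- Updated information vector at time `k`. -/
def updatedY (k : ℕ) : M.Aug k → ℝ := M.updVec k (M.backward k).1

/-- Information vector after the backward propagation from time `k + 1` to time `k`, before the
clone `k` is merged with the current state. -/
def unmergedY (k : ℕ) : M.Aug (k + 1) → ℝ :=
  (M.Fprop k)ᵀ *ᵥ ((1 + M.updatedJ (k + 1) * M.Qaug k)⁻¹ *ᵥ
    (M.updatedY (k + 1) - M.updatedJ (k + 1) *ᵥ M.uaug k))

/-- Information matrix after the backward propagation from time `k + 1` to time `k`, before the
clone `k` is merged with the current state. -/
def unmergedJ (k : ℕ) : Matrix (M.Aug (k + 1)) (M.Aug (k + 1)) ℝ :=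
  (M.Fprop k)ᵀ * (1 + M.updatedJ (k + 1) * M.Qaug k)⁻¹ * M.updatedJ (k + 1) * M.Fprop k

/-! ### Fusion -/

/-- The fused augmented state at time `k`. -/
def fused (k : ℕ) : M.Aug k → ℝ :=
  (1 + (M.forward k).2 * (M.backward k).2)⁻¹ *ᵥ
    ((M.forward k).1 + (M.forward k).2 *ᵥ (M.backward k).1)

/-- The output of the SC-BIFM algorithm. -/
def scbifm : M.Trajectory := fun k a => M.fused k (Sum.inl a)

end SmoothingProblem

end

noncomputable section

/-! The algorithm solves the optimality system of the least-squares problem, and every step is a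
linear relation between a state and a costate, in which covariances are multiplied but never
inverted. Put `λ_k = y_k - J_k x_k`, where `x_k` is the fused augmented state. Fusion then says that
`x_k` is the filtered mean plus `P_k λ_k`. With `s_k = R_k⁻¹ (z_k - H_k x_k)` and `μ_k = λ_k + H_kᵀ
s_k`, `fused_succ` gives the two-point boundary problem `x_{k+1} = F_k x_k + u_k + Q_k μ_{k+1}`,
`λ_k = F_kᵀ μ_{k+1}`, with `λ_N = 0`.

Clones carry no noise, so the fused clones agree with the earlier fused states and the augmented
solution comes from one trajectory. Its residuals are `P_0 λ_0`, `Q_k μ_{k+1}` and `-R_k s_k`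
(current-state blocks): they lie in the ranges of the covariances, so the cost is finite. The cost
lies above the sum of its tangents there, and the linear terms telescope to zero by the adjoint
recursion (`stationarity`). Equality of costs forces equal prior and dynamics residuals, hence equal
trajectories. The positive definite case is the same statement read in the reals.

Invertibility and semidefiniteness rest on one fact: for positive semidefinite `A`, `B`, the matrix
`1 + A B` is invertible and `(1 + A B)⁻¹ A` is positive semidefinite. -/

/-! ### Products of positive semidefinite matrices -/

/-- If `v = -A B v`, pairing with `B v` gives `v·Bv = -(Bv)·A(Bv) ≤ 0`, so `B v = 0` and then `v =
0`. -/
theorem Matrix.PosSemidef.isUnit_one_add_mul {ι : Type*} [Fintype ι] [DecidableEq ι]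
    {A B : Matrix ι ι ℝ} (hA : A.PosSemidef) (hB : B.PosSemidef) : IsUnit (1 + A * B) := by
  rw [← Matrix.mulVec_injective_iff_isUnit, ← Matrix.coe_mulVecLin, injective_iff_map_eq_zero]
  intro v hv
  have hv' : v = -(A *ᵥ (B *ᵥ v)) := by
    rw [Matrix.mulVecLin_apply, Matrix.add_mulVec, Matrix.one_mulVec, ← Matrix.mulVec_mulVec] at hv
    exact eq_neg_of_add_eq_zero_left hv
  have h1 : 0 ≤ (B *ᵥ v) ⬝ᵥ (A *ᵥ (B *ᵥ v)) := by
    simpa using hA.dotProduct_mulVec_nonneg (B *ᵥ v)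
  have h2 : 0 ≤ v ⬝ᵥ (B *ᵥ v) := by simpa using hB.dotProduct_mulVec_nonneg v
  have h3 : v ⬝ᵥ (B *ᵥ v) = -((B *ᵥ v) ⬝ᵥ (A *ᵥ (B *ᵥ v))) := by
    have := congrArg (· ⬝ᵥ (B *ᵥ v)) hv'
    simpa only [neg_dotProduct, dotProduct_comm (A *ᵥ _)] using this
  have h4 : B *ᵥ v = 0 :=
    (hB.dotProduct_mulVec_zero_iff v).1 (by simpa using (by linarith : v ⬝ᵥ (B *ᵥ v) = 0))
  rw [hv', h4]; simp

/-- A congruence: since `A + A B A = A (1 + B A)` and `1 + B A = (1 + A B)ᵀ`, the matrix is `(1 + A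
B)⁻¹ (A + A B A) (1 + A B)⁻ᵀ`. -/
theorem Matrix.PosSemidef.inv_one_add_mul_mul {ι : Type*} [Fintype ι] [DecidableEq ι]
    {A B : Matrix ι ι ℝ} (hA : A.PosSemidef) (hB : B.PosSemidef) :
    ((1 + A * B)⁻¹ * A).PosSemidef := by
  have hu := hA.isUnit_one_add_mul hB
  have hAt : Aᵀ = A := hA.isHermitian
  have hBt : Bᵀ = B := hB.isHermitian
  have hT : (1 + A * B)ᵀ = 1 + B * A := by
    rw [Matrix.transpose_add, Matrix.transpose_mul, hAt, hBt, Matrix.transpose_one]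
  have hu' : IsUnit (1 + B * A) := hB.isUnit_one_add_mul hA
  have hpsd : (A + A * B * A).PosSemidef := by
    refine hA.add ?_
    have := hB.mul_mul_conjTranspose_same A
    rwa [Matrix.conjTranspose_eq_transpose_of_trivial, hAt] at this
  have := hpsd.mul_mul_conjTranspose_same (1 + A * B)⁻¹
  rw [Matrix.conjTranspose_eq_transpose_of_trivial, Matrix.transpose_nonsing_inv, hT,
    show A + A * B * A = A * (1 + B * A) by noncomm_ring, Matrix.mul_assoc, Matrix.mul_assoc,
    Matrix.mul_nonsing_inv _ ((Matrix.isUnit_iff_isUnit_det _).1 hu'), Matrix.mul_one] at this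
  exact this

theorem Matrix.PosSemidef.innovation_posDef {ι κ : Type*} [Fintype ι] [Fintype κ] [DecidableEq κ]
    {P : Matrix ι ι ℝ} {R : Matrix κ κ ℝ} (hP : P.PosSemidef) (hR : R.PosDef)
    (H : Matrix κ ι ℝ) : (H * P * Hᵀ + R).PosDef := by
  have := hP.mul_mul_conjTranspose_same H
  rw [Matrix.conjTranspose_eq_transpose_of_trivial] at this
  exact Matrix.PosDef.posSemidef_add this hR

/-- The measurement update of a covariance matrix, in information form. -/
theorem Matrix.PosSemidef.sub_gain_mul {ι κ : Type*} [Fintype ι] [DecidableEq ι] [Fintype κ]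
    [DecidableEq κ] {P : Matrix ι ι ℝ} {R : Matrix κ κ ℝ} (hP : P.PosSemidef) (hR : R.PosDef)
    (H : Matrix κ ι ℝ) :
    P - P * Hᵀ * (H * P * Hᵀ + R)⁻¹ * H * P = (1 + P * (Hᵀ * R⁻¹ * H))⁻¹ * P := by
  have hB : (Hᵀ * R⁻¹ * H).PosSemidef := by
    simpa using hR.inv.posSemidef.conjTranspose_mul_mul_same H
  have hu := (Matrix.isUnit_iff_isUnit_det _).1 (hP.isUnit_one_add_mul hB)
  have hS := (Matrix.isUnit_iff_isUnit_det _).1 (hP.innovation_posDef hR H).isUnit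
  have hRu := (Matrix.isUnit_iff_isUnit_det _).1 hR.isUnit
  set S := H * P * Hᵀ + R with hSdef
  have key : (1 + P * (Hᵀ * R⁻¹ * H)) * (P * Hᵀ) = P * Hᵀ * R⁻¹ * S := by
    rw [hSdef, Matrix.mul_add, Matrix.mul_assoc _ R⁻¹ R, Matrix.nonsing_inv_mul _ hRu,
      Matrix.add_mul, Matrix.one_mul, Matrix.mul_one]
    simp only [Matrix.mul_assoc]
    exact add_comm _ _
  have h : (1 + P * (Hᵀ * R⁻¹ * H)) * (P - P * Hᵀ * S⁻¹ * H * P) = P := by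
    rw [Matrix.mul_sub, show P * Hᵀ * S⁻¹ * H * P = P * Hᵀ * (S⁻¹ * H * P) by
      simp only [Matrix.mul_assoc], ← Matrix.mul_assoc _ (P * Hᵀ), key]
    rw [show P * Hᵀ * R⁻¹ * S * (S⁻¹ * H * P) = P * Hᵀ * R⁻¹ * (S * S⁻¹) * (H * P) by
      simp only [Matrix.mul_assoc], Matrix.mul_nonsing_inv _ hS, Matrix.mul_one, Matrix.add_mul,
      Matrix.one_mul]
    simp only [Matrix.mul_assoc]
    exact add_sub_cancel_right _ _
  rw [← Matrix.nonsing_inv_mul_cancel_left _ (P - _) hu, h]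

/-! ### The extended Mahalanobis norm -/

theorem mahalanobisSqExt_mulVec {ι : Type*} [Fintype ι] {P : Matrix ι ι ℝ} (hP : P.PosSemidef)
    (v : ι → ℝ) : mahalanobisSqExt P (P *ᵥ v) = ENNReal.ofReal (v ⬝ᵥ (P *ᵥ v)) := by
  have ht : Pᵀ = P := hP.isHermitian
  refine le_antisymm (iInf_le_of_le ⟨v, rfl⟩ le_rfl) (le_iInf fun w => ?_)
  obtain ⟨w, hw⟩ := w
  have : v ⬝ᵥ (P *ᵥ v) = w ⬝ᵥ (P *ᵥ w) := by
    conv_lhs => rw [← hw]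
    rw [Matrix.dotProduct_mulVec, ← Matrix.mulVec_transpose, ht, ← hw, dotProduct_comm]
  rw [this]

theorem mahalanobisSqExt_eq_ofReal {ι : Type*} [Fintype ι] [DecidableEq ι] {P : Matrix ι ι ℝ}
    (hP : P.PosDef) (e : ι → ℝ) :
    mahalanobisSqExt P e = ENNReal.ofReal (mahalanobisSq P e) ∧ 0 ≤ mahalanobisSq P e := by
  have he : P *ᵥ (P⁻¹ *ᵥ e) = e := by
    rw [Matrix.mulVec_mulVec, Matrix.mul_nonsing_inv _ ((Matrix.isUnit_iff_isUnit_det _).1 hP.isUnit),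
      Matrix.one_mulVec]
  constructor
  · conv_lhs => rw [← he]
    rw [mahalanobisSqExt_mulVec hP.posSemidef, he, dotProduct_comm, mahalanobisSq]
  · simpa [mahalanobisSq] using hP.inv.posSemidef.dotProduct_mulVec_nonneg e

/-- Strict convexity of the extended squared Mahalanobis norm: it lies above its tangent at `P v`,
strictly so away from `P v`. -/
theorem mahalanobisSqExt_tangent {ι : Type*} [Fintype ι] {P : Matrix ι ι ℝ} (hP : P.PosSemidef)
    (v e : ι → ℝ) (he : mahalanobisSqExt P e ≠ ⊤) :
    v ⬝ᵥ (P *ᵥ v) + 2 * (v ⬝ᵥ (e - P *ᵥ v)) ≤ (mahalanobisSqExt P e).toReal ∧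
    (e ≠ P *ᵥ v →
      v ⬝ᵥ (P *ᵥ v) + 2 * (v ⬝ᵥ (e - P *ᵥ v)) < (mahalanobisSqExt P e).toReal) := by
  have ht : Pᵀ = P := hP.isHermitian
  obtain ⟨w, rfl⟩ : ∃ w, P *ᵥ w = e := by
    by_contra! h
    have : IsEmpty {w : ι → ℝ // P *ᵥ w = e} := ⟨fun w => h w.1 w.2⟩
    exact he (iInf_of_empty _)
  have hw : 0 ≤ w ⬝ᵥ (P *ᵥ w) := by simpa using hP.dotProduct_mulVec_nonneg w
  have hd : 0 ≤ (w - v) ⬝ᵥ (P *ᵥ (w - v)) := by simpa using hP.dotProduct_mulVec_nonneg (w - v)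
  rw [mahalanobisSqExt_mulVec hP, ENNReal.toReal_ofReal hw]
  have hsymm : w ⬝ᵥ (P *ᵥ v) = v ⬝ᵥ (P *ᵥ w) := by
    rw [Matrix.dotProduct_mulVec, ← Matrix.mulVec_transpose, ht, dotProduct_comm]
  -- Exact second-order expansion; the remainder vanishes only if `P (w - v) = 0`.
  have hexp : w ⬝ᵥ (P *ᵥ w) = v ⬝ᵥ (P *ᵥ v) + 2 * (v ⬝ᵥ (P *ᵥ w - P *ᵥ v))
      + (w - v) ⬝ᵥ (P *ᵥ (w - v)) := by
    simp only [Matrix.mulVec_sub, dotProduct_sub, sub_dotProduct, hsymm]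
    ring
  refine ⟨by linarith, fun hne => ?_⟩
  have : (w - v) ⬝ᵥ (P *ᵥ (w - v)) ≠ 0 := fun h0 => hne <| by
    have := (hP.dotProduct_mulVec_zero_iff (w - v)).1 (by simpa using h0)
    rwa [Matrix.mulVec_sub, sub_eq_zero] at this
  have := lt_of_le_of_ne hd this.symm
  linarith

namespace SmoothingProblem

variable (M : SmoothingProblem)

/-! ### Discarding and cloning as one selection of coordinates -/

/-- The coordinate of the augmented state at time `k` from which a coordinate at time `k + 1` is
copied by discarding and cloning. -/
def source (k : ℕ) : M.Aug (k + 1) → M.Aug k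
  | Sum.inl a => Sum.inl a
  | Sum.inr (i, a) =>
      if h : i.1 = k then Sum.inl a
      else Sum.inr (⟨i.1, (Finset.mem_inter.1 (M.mem_kept i.2 h)).1⟩, a)

theorem duplicate_mul_discard (k : ℕ) :
    M.duplicate k * M.discard k
      = (1 : Matrix (M.Aug k) (M.Aug k) ℝ).submatrix (M.source k) id := by
  rw [duplicate, ← Matrix.submatrix_id_id (M.discard k), ← Matrix.submatrix_mul _ _ _ id _ Function.bijective_id,
    Matrix.one_mul, discard, Matrix.submatrix_submatrix]
  congr 1
  funext r
  rcases r with a | ⟨i, a⟩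
  · rfl
  · by_cases h : i.1 = k <;> simp [source, h]

theorem Faug_eq (k : ℕ) : M.Faug k
    = M.Fprop k * (1 : Matrix (M.Aug k) (M.Aug k) ℝ).submatrix (M.source k) id := by
  rw [Faug, Matrix.mul_assoc, duplicate_mul_discard]

theorem source_mulVec (k : ℕ) (x : M.Aug k → ℝ) :
    (1 : Matrix (M.Aug k) (M.Aug k) ℝ).submatrix (M.source k) id *ᵥ x = x ∘ M.source k := by
  funext r
  simp [Matrix.mulVec, dotProduct, Matrix.one_apply]

/-- The fibre of `source` over a current-state coordinate has two points, the state itself and its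
new clone; this is the merging rule. -/
theorem sum_source_inl (k : ℕ) (h : k ∈ M.clones (k + 1)) (a : Fin M.n) (y : M.Aug (k + 1) → ℝ) :
    ∑ r, (if M.source k r = Sum.inl a then y r else 0)
      = y (Sum.inl a) + y (Sum.inr (⟨k, h⟩, a)) := by
  rw [Fintype.sum_sum_type]
  congr 1
  · simp [source]
  · rw [Finset.sum_eq_single (⟨k, h⟩, a)]
    · simp [source]
    · rintro ⟨i, b⟩ - hne
      refine if_neg ?_
      by_cases hi : i.1 = k
      · have : i = ⟨k, h⟩ := Subtype.ext hi
        subst this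
        simpa [source] using fun hb => hne (by rw [hb])
      · simp [source, hi]
    · simp

theorem source_ne_inr (k : ℕ) (i : {i // i ∈ M.clones k}) (hi : i.1 ∉ M.clones (k + 1))
    (a : Fin M.n) (r : M.Aug (k + 1)) : M.source k r ≠ Sum.inr (i, a) := by
  rcases r with b | ⟨j, b⟩
  · simp [source]
  · by_cases hj : j.1 = k
    · simp [source, hj]
    · simp only [source, hj, dif_neg, not_false_eq_true, ne_eq, Sum.inr.injEq, Prod.mk.injEq, not_and]
      rintro rfl
      exact absurd j.2 hi

/-! ### Semidefiniteness along both passes -/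

theorem posSemidef_fromBlocks_zero {ι κ : Type*} [Fintype ι] [Fintype κ] [DecidableEq ι]
    {A : Matrix ι ι ℝ} (hA : A.PosSemidef) :
    (Matrix.fromBlocks A 0 0 (0 : Matrix κ κ ℝ)).PosSemidef := by
  have := hA.mul_mul_conjTranspose_same (Matrix.fromRows (1 : Matrix ι ι ℝ) (0 : Matrix κ ι ℝ))
  rw [Matrix.conjTranspose_eq_transpose_of_trivial, Matrix.transpose_fromRows,
    Matrix.fromRows_mul, Matrix.fromRows_mul_fromCols] at this
  simpa using this

theorem predCov_posSemidef {k : ℕ} (hQ : (M.Q k).PosSemidef) {P : Matrix (M.Aug k) (M.Aug k) ℝ}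
    (hP : P.PosSemidef) : (M.predCov k P).PosSemidef := by
  refine Matrix.PosSemidef.add ?_ (posSemidef_fromBlocks_zero hQ)
  simpa using hP.mul_mul_conjTranspose_same (M.Faug k)

theorem info_posSemidef {k : ℕ} (hR : (M.R k).PosDef) :
    ((M.Haug k)ᵀ * (M.R k)⁻¹ * M.Haug k).PosSemidef := by
  simpa using hR.inv.posSemidef.conjTranspose_mul_mul_same (M.Haug k)

theorem forward_posSemidef (hP0 : M.P0.PosSemidef)
    (hQ : ∀ k, k < M.N → (M.Q k).PosSemidef)
    (hR : ∀ k, 1 ≤ k → k ≤ M.N → (M.R k).PosDef) (k : ℕ) (hk : k ≤ M.N) :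
    (M.forward k).2.PosSemidef := by
  induction k with
  | zero => exact posSemidef_fromBlocks_zero hP0
  | succ k ih =>
    have hR' := hR (k + 1) (by omega) hk
    have hP := M.predCov_posSemidef (hQ k hk) (ih (by omega))
    have := hP.inv_one_add_mul_mul (M.info_posSemidef hR')
    rwa [← hP.sub_gain_mul hR'] at this

theorem backward_of_lt {k : ℕ} (hk : k < M.N) :
    M.backward k =
      ((M.Faug k)ᵀ *ᵥ ((1 + M.updatedJ (k + 1) * M.Qaug k)⁻¹ *ᵥ
        (M.updatedY (k + 1) - M.updatedJ (k + 1) *ᵥ M.uaug k)),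
      (M.Faug k)ᵀ * (1 + M.updatedJ (k + 1) * M.Qaug k)⁻¹ * M.updatedJ (k + 1) * M.Faug k) := by
  rw [backward, if_pos hk]
  rfl

theorem backward_of_le {k : ℕ} (hk : M.N ≤ k) : M.backward k = (0, 0) := by
  rw [backward, if_neg (by omega)]

theorem backward_posSemidef (hQ : ∀ k, k < M.N → (M.Q k).PosSemidef)
    (hR : ∀ k, 1 ≤ k → k ≤ M.N → (M.R k).PosDef) (k : ℕ) :
    (M.backward k).2.PosSemidef := by
  by_cases hk : k < M.N
  · have hJ : (M.updatedJ (k + 1)).PosSemidef :=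
      (backward_posSemidef hQ hR (k + 1)).add (M.info_posSemidef (hR _ (by omega) hk))
    have := (hJ.inv_one_add_mul_mul (posSemidef_fromBlocks_zero (hQ k hk)
      (κ := {i // i ∈ M.clones (k + 1)} × Fin M.n))).conjTranspose_mul_mul_same (M.Faug k)
    rw [M.backward_of_lt hk]
    simpa only [Qaug, Matrix.mul_assoc, Matrix.conjTranspose_eq_transpose_of_trivial] using this
  · rw [M.backward_of_le (by omega)]
    exact Matrix.PosSemidef.zero
termination_by M.N - k

theorem updatedJ_posSemidef (hQ : ∀ k, k < M.N → (M.Q k).PosSemidef)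
    (hR : ∀ k, 1 ≤ k → k ≤ M.N → (M.R k).PosDef) {k : ℕ} (h1 : 1 ≤ k) (hk : k ≤ M.N) :
    (M.updatedJ k).PosSemidef :=
  (M.backward_posSemidef hQ hR k).add (M.info_posSemidef (hR k h1 hk))

/-! ### Merging of clones -/

/-- The transpose of a selection of coordinates sums over the fibres of the selection. -/
theorem backward_vec_eq {k : ℕ} (hk : k < M.N) (c : M.Aug k) :
    (M.backward k).1 c = ∑ r, if M.source k r = c then M.unmergedY k r else 0 := by
  rw [M.backward_of_lt hk, M.Faug_eq, Matrix.transpose_mul, ← Matrix.mulVec_mulVec]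
  change (_ *ᵥ M.unmergedY k) c = _
  simp [Matrix.mulVec, dotProduct, Matrix.one_apply]

theorem backward_mat_eq {k : ℕ} (hk : k < M.N) (c d : M.Aug k) :
    (M.backward k).2 c d = ∑ r, if M.source k r = c then
      (∑ s, if M.source k s = d then M.unmergedJ k r s else 0) else 0 := by
  have : (M.backward k).2 = ((1 : Matrix (M.Aug k) (M.Aug k) ℝ).submatrix (M.source k) id)ᵀ *
      (M.unmergedJ k * (1 : Matrix (M.Aug k) (M.Aug k) ℝ).submatrix (M.source k) id) := by
    rw [M.backward_of_lt hk, M.Faug_eq, Matrix.transpose_mul, unmergedJ]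
    simp only [Matrix.mul_assoc]
  rw [this]
  simp only [Matrix.mul_apply, Matrix.one_apply, Matrix.transpose_apply, Matrix.submatrix_apply, id,
    mul_ite, ite_mul, mul_one, mul_zero, one_mul, zero_mul]

/-! ### The optimality system -/

/-- The costate that belongs to the fused augmented state. -/
def costate (k : ℕ) : M.Aug k → ℝ := (M.backward k).1 - (M.backward k).2 *ᵥ M.fused k

/-- The weighted innovation of the fused state with respect to the observation made at time `k`. -/
def innovCostate (k : ℕ) : Fin (M.p k) → ℝ := (M.R k)⁻¹ *ᵥ (M.z k - M.Haug k *ᵥ M.fused k)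

/-- The costate that includes the observation made at time `k`. -/
def updCostate (k : ℕ) : M.Aug k → ℝ := M.costate k + (M.Haug k)ᵀ *ᵥ M.innovCostate k

theorem mulVec_inv_mulVec {ι : Type*} [Fintype ι] [DecidableEq ι] {A : Matrix ι ι ℝ}
    (hA : IsUnit A) (v : ι → ℝ) : A *ᵥ (A⁻¹ *ᵥ v) = v := by
  rw [Matrix.mulVec_mulVec, Matrix.mul_nonsing_inv _ ((Matrix.isUnit_iff_isUnit_det _).1 hA),
    Matrix.one_mulVec]

theorem eq_inv_mulVec {ι : Type*} [Fintype ι] [DecidableEq ι] {A : Matrix ι ι ℝ}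
    (hA : IsUnit A) {v w : ι → ℝ} (h : A *ᵥ v = w) : v = A⁻¹ *ᵥ w := by
  rw [← h, Matrix.mulVec_mulVec, Matrix.nonsing_inv_mul _ ((Matrix.isUnit_iff_isUnit_det _).1 hA),
    Matrix.one_mulVec]

/-- The fusion equation `(1 + P J) x = m + P y` with the term `P J x` moved to the right. -/
theorem fused_eq {k : ℕ} (h : IsUnit (1 + (M.forward k).2 * (M.backward k).2)) :
    M.fused k = (M.forward k).1 + (M.forward k).2 *ᵥ M.costate k := by
  have := mulVec_inv_mulVec h ((M.forward k).1 + (M.forward k).2 *ᵥ (M.backward k).1)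
  rw [← fused, Matrix.add_mulVec, Matrix.one_mulVec, ← Matrix.mulVec_mulVec] at this
  rw [costate, Matrix.mulVec_sub, ← add_sub_assoc, ← this, add_sub_cancel_right]

/-- Eliminating `x` from `R s = z - H x` gives `(H P Hᵀ + R) s = z - H m - H P l`. Thus the
observation passes from the costate into the mean and covariance. -/
theorem kalman_update {ι κ : Type*} [Fintype ι] [Fintype κ] [DecidableEq κ] {P : Matrix ι ι ℝ}
    {R : Matrix κ κ ℝ} {H : Matrix κ ι ℝ} (hR : IsUnit R) (hS : IsUnit (H * P * Hᵀ + R))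
    (x m l : ι → ℝ) (z : κ → ℝ) (hx : x = m + P *ᵥ (l + Hᵀ *ᵥ (R⁻¹ *ᵥ (z - H *ᵥ x)))) :
    x = (m + (P * Hᵀ * (H * P * Hᵀ + R)⁻¹) *ᵥ (z - H *ᵥ m)) +
      (P - P * Hᵀ * (H * P * Hᵀ + R)⁻¹ * H * P) *ᵥ l := by
  set s := R⁻¹ *ᵥ (z - H *ᵥ x) with hs
  have hRs : R *ᵥ s = z - H *ᵥ x := mulVec_inv_mulVec hR _
  have hSs : (H * P * Hᵀ + R) *ᵥ s = z - H *ᵥ m - H *ᵥ (P *ᵥ l) := by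
    rw [Matrix.add_mulVec, hRs]
    nth_rewrite 1 [hx]
    simp only [Matrix.mulVec_add, ← Matrix.mulVec_mulVec]
    abel
  have hs' := eq_inv_mulVec hS hSs
  set S := H * P * Hᵀ + R
  rw [hx]
  nth_rewrite 1 [hs']
  simp only [Matrix.mulVec_add, Matrix.mulVec_sub, Matrix.sub_mulVec, ← Matrix.mulVec_mulVec]
  abel

/-- The costate `l` drives the noise `Q l`, which changes the state at which `l` is evaluated;
solving this implicit equation produces the factor `(1 + J Q)⁻¹` of the backward pass. -/
theorem info_prediction {ι κ : Type*} [Fintype ι] [Fintype κ] [DecidableEq κ] {F : Matrix κ ι ℝ}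
    {J Q : Matrix κ κ ℝ} (h : IsUnit (1 + J * Q)) (x : ι → ℝ) (u y : κ → ℝ) :
    ∃ l : κ → ℝ, l = y - J *ᵥ (F *ᵥ x + u + Q *ᵥ l) ∧
      Fᵀ *ᵥ ((1 + J * Q)⁻¹ *ᵥ (y - J *ᵥ u)) - (Fᵀ * (1 + J * Q)⁻¹ * J * F) *ᵥ x = Fᵀ *ᵥ l := by
  refine ⟨(1 + J * Q)⁻¹ *ᵥ (y - J *ᵥ u - J *ᵥ (F *ᵥ x)), ?_, ?_⟩
  · have := mulVec_inv_mulVec h (y - J *ᵥ u - J *ᵥ (F *ᵥ x))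
    set l := (1 + J * Q)⁻¹ *ᵥ (y - J *ᵥ u - J *ᵥ (F *ᵥ x))
    rw [Matrix.add_mulVec, Matrix.one_mulVec, ← Matrix.mulVec_mulVec] at this
    simp only [Matrix.mulVec_add]
    rw [← eq_sub_iff_add_eq] at this
    nth_rewrite 1 [this]
    abel
  · simp only [Matrix.mulVec_sub, ← Matrix.mulVec_mulVec]

theorem isUnit_innovCov (hP0 : M.P0.PosSemidef) (hQ : ∀ k, k < M.N → (M.Q k).PosSemidef)
    (hR : ∀ k, 1 ≤ k → k ≤ M.N → (M.R k).PosDef) {k : ℕ} (hk : k < M.N) :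
    IsUnit (M.innovCov (k + 1) (M.predCov k (M.forward k).2)) :=
  ((M.predCov_posSemidef (hQ k hk) (M.forward_posSemidef hP0 hQ hR k hk.le)).innovation_posDef
    (hR _ (by omega) hk) _).isUnit

theorem isUnit_updatedJ (hQ : ∀ k, k < M.N → (M.Q k).PosSemidef)
    (hR : ∀ k, 1 ≤ k → k ≤ M.N → (M.R k).PosDef) {k : ℕ} (hk : k < M.N) :
    IsUnit (1 + M.updatedJ (k + 1) * M.Qaug k) :=
  (M.updatedJ_posSemidef hQ hR (by omega) hk).isUnit_one_add_mul
    (posSemidef_fromBlocks_zero (hQ k hk))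

theorem isUnit_fusion (hP0 : M.P0.PosSemidef) (hQ : ∀ k, k < M.N → (M.Q k).PosSemidef)
    (hR : ∀ k, 1 ≤ k → k ≤ M.N → (M.R k).PosDef) {k : ℕ} (hk : k ≤ M.N) :
    IsUnit (1 + (M.forward k).2 * (M.backward k).2) :=
  (M.forward_posSemidef hP0 hQ hR k hk).isUnit_one_add_mul (M.backward_posSemidef hQ hR k)

/-- The fused states solve the dynamics, and the costates the adjoint dynamics. -/
theorem fused_succ (hP0 : M.P0.PosSemidef) (hQ : ∀ k, k < M.N → (M.Q k).PosSemidef)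
    (hR : ∀ k, 1 ≤ k → k ≤ M.N → (M.R k).PosDef) {k : ℕ} (hk : k < M.N) :
    M.fused (k + 1)
      = M.Faug k *ᵥ M.fused k + M.uaug k + M.Qaug k *ᵥ M.updCostate (k + 1) ∧
    M.costate k = (M.Faug k)ᵀ *ᵥ M.updCostate (k + 1) := by
  -- `l` and the state `x` that it drives are candidates for `updCostate` and `fused` at time `k +
  -- 1`; it remains to see that `x` solves the fusion equation there, whose solution is unique.
  obtain ⟨l, hl, hl'⟩ := info_prediction (F := M.Faug k) (M.isUnit_updatedJ hQ hR hk)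
    (M.fused k) (M.uaug k) (M.updatedY (k + 1))
  set x := M.Faug k *ᵥ M.fused k + M.uaug k + M.Qaug k *ᵥ l with hx
  have hcost : M.costate k = (M.Faug k)ᵀ *ᵥ l := by rw [costate, M.backward_of_lt hk, hl']
  have hR' := hR (k + 1) (by omega) hk
  have hxP : x = M.predMean k (M.forward k).1 + M.predCov k (M.forward k).2 *ᵥ l := by
    rw [hx, M.fused_eq (M.isUnit_fusion hP0 hQ hR hk.le), hcost, predMean, predCov]
    simp only [Matrix.mulVec_add, Matrix.add_mulVec, ← Matrix.mulVec_mulVec]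
    abel
  have hlx : l = ((M.backward (k + 1)).1 - (M.backward (k + 1)).2 *ᵥ x) +
      (M.Haug (k + 1))ᵀ *ᵥ ((M.R (k + 1))⁻¹ *ᵥ (M.z (k + 1) - M.Haug (k + 1) *ᵥ x)) := by
    rw [hl, updatedY, updatedJ, updVec, updMat]
    simp only [Matrix.mulVec_sub, Matrix.add_mulVec, ← Matrix.mulVec_mulVec]
    abel
  have hupd : x = (M.forward (k + 1)).1 + (M.forward (k + 1)).2 *ᵥ
      ((M.backward (k + 1)).1 - (M.backward (k + 1)).2 *ᵥ x) :=
    kalman_update hR'.isUnit (M.isUnit_innovCov hP0 hQ hR hk) _ _ _ _ (by rwa [← hlx])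
  have hfused : x = M.fused (k + 1) := by
    refine eq_inv_mulVec (M.isUnit_fusion hP0 hQ hR hk) ?_
    rw [Matrix.add_mulVec, Matrix.one_mulVec, ← Matrix.mulVec_mulVec]
    nth_rewrite 1 [hupd]
    rw [Matrix.mulVec_sub]
    abel
  have hlu : l = M.updCostate (k + 1) := by
    rw [hlx, hfused]
    rfl
  rw [← hlu, ← hfused]
  exact ⟨rfl, hcost⟩

/-! ### Augmentation of trajectories -/

/-- The augmented state at time `k` of a sequence of states. -/
def augment (x : ℕ → Fin M.n → ℝ) (k : ℕ) : M.Aug k → ℝ :=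
  Sum.elim (x k) fun c => x c.1.1 c.2

theorem Faug_mulVec (k : ℕ) (x : M.Aug k → ℝ) :
    M.Faug k *ᵥ x = Sum.elim (M.F k *ᵥ (x ∘ Sum.inl)) (x ∘ M.source k ∘ Sum.inr) := by
  rw [Faug_eq, ← Matrix.mulVec_mulVec, source_mulVec, Fprop, Matrix.fromBlocks_mulVec]
  simp only [Matrix.zero_mulVec, add_zero, zero_add, Matrix.one_mulVec]
  rfl

theorem augment_source_inr (x : ℕ → Fin M.n → ℝ) (k : ℕ)
    (c : {i // i ∈ M.clones (k + 1)} × Fin M.n) :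
    M.augment x k (M.source k (Sum.inr c)) = x c.1.1 c.2 := by
  obtain ⟨i, a⟩ := c
  by_cases h : i.1 = k
  · simp [source, h, augment]
  · simp [source, h, augment]

/-- Clones are copied exactly, so an arbitrary sequence violates the augmented dynamics only in the
current-state block. -/
theorem Faug_mulVec_augment (x : ℕ → Fin M.n → ℝ) (k : ℕ) :
    M.Faug k *ᵥ M.augment x k
      = M.augment x (k + 1) - Sum.elim (x (k + 1) - M.F k *ᵥ x k) 0 := by
  rw [Faug_mulVec]
  funext r
  rcases r with a | c
  · simp [augment, Function.comp_def]
  · simpa [augment] using M.augment_source_inr x k c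

theorem Haug_mulVec_augment (x : ℕ → Fin M.n → ℝ) {k : ℕ} (hk : k ≤ M.N) :
    M.Haug k *ᵥ M.augment x k = M.H k *ᵥ x k + ∑ l ∈ M.L k, M.Hpast k l *ᵥ x l := by
  rw [Haug, augment, Matrix.fromCols_mulVec_sumElim]
  congr 1
  funext r
  rw [Finset.sum_apply]
  simp only [Matrix.mulVec, dotProduct, Matrix.of_apply, Fintype.sum_prod_type]
  symm
  have hmem : ∀ l ∈ M.L k, (l : ℕ) ∈ M.clones k := fun l hl =>
    Finset.mem_filter.2 ⟨Finset.mem_range.2 l.2, k, Finset.mem_Icc.2 ⟨le_rfl, hk⟩, l, hl, rfl⟩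
  -- Clones waiting for a later observation have zero columns, so only nonzero terms are matched.
  refine Finset.sum_bij_ne_zero (fun l hl _ => ⟨l, hmem l hl⟩) (fun _ _ _ => Finset.mem_univ _)
    (fun l₁ _ _ l₂ _ _ h => Fin.ext (congrArg Subtype.val h)) ?_ ?_
  · intro i _ hi
    by_cases h : (⟨i.1, M.lt_of_mem_clones i.2⟩ : Fin k) ∈ M.L k
    · refine ⟨_, h, ?_, rfl⟩
      simpa [h] using hi
    · simp [h] at hi
  · intro l hl _
    simp [hl]

/-- The fused states, without the clones. -/
def smoothed (k : ℕ) : Fin M.n → ℝ := M.fused k ∘ Sum.inl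

/-- The clone rows of `Qaug` and `uaug` vanish, so each fused clone is carried over unchanged from
the time of its creation. -/
theorem fused_eq_augment (hP0 : M.P0.PosSemidef) (hQ : ∀ k, k < M.N → (M.Q k).PosSemidef)
    (hR : ∀ k, 1 ≤ k → k ≤ M.N → (M.R k).PosDef) (k : ℕ) (hk : k ≤ M.N) :
    M.fused k = M.augment M.smoothed k := by
  induction k with
  | zero =>
    funext r
    rcases r with a | ⟨i, a⟩
    · rfl
    · exact absurd (M.lt_of_mem_clones i.2) (Nat.not_lt_zero _)
  | succ k ih =>
    funext r
    rcases r with a | c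
    · rfl
    · rw [(M.fused_succ hP0 hQ hR hk).1, ih (by omega), Faug_mulVec_augment, Qaug,
        Matrix.fromBlocks_mulVec]
      simp [uaug]

theorem smoothed_zero (hP0 : M.P0.PosSemidef) (hQ : ∀ k, k < M.N → (M.Q k).PosSemidef)
    (hR : ∀ k, 1 ≤ k → k ≤ M.N → (M.R k).PosDef) :
    M.smoothed 0 - M.z0 = M.P0 *ᵥ (M.costate 0 ∘ Sum.inl) := by
  rw [smoothed, M.fused_eq (M.isUnit_fusion hP0 hQ hR (Nat.zero_le _)), forward,
    Matrix.fromBlocks_mulVec]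
  funext a
  simp

theorem smoothed_succ (hP0 : M.P0.PosSemidef) (hQ : ∀ k, k < M.N → (M.Q k).PosSemidef)
    (hR : ∀ k, 1 ≤ k → k ≤ M.N → (M.R k).PosDef) {k : ℕ} (hk : k < M.N) :
    M.smoothed (k + 1) - M.F k *ᵥ M.smoothed k - M.u k
      = M.Q k *ᵥ (M.updCostate (k + 1) ∘ Sum.inl) := by
  nth_rewrite 1 [smoothed]
  rw [(M.fused_succ hP0 hQ hR hk).1, Faug_mulVec, Qaug, Matrix.fromBlocks_mulVec]
  funext a
  simp only [uaug, smoothed, Pi.sub_apply, Pi.add_apply, Function.comp_apply, Sum.elim_inl,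
    Matrix.zero_mulVec, add_zero]
  ring

theorem smoothed_obs (hP0 : M.P0.PosSemidef) (hQ : ∀ k, k < M.N → (M.Q k).PosSemidef)
    (hR : ∀ k, 1 ≤ k → k ≤ M.N → (M.R k).PosDef) {k : ℕ} (hk : k < M.N) :
    M.Haug (k + 1) *ᵥ M.augment M.smoothed (k + 1) - M.z (k + 1)
      = M.R (k + 1) *ᵥ (-M.innovCostate (k + 1)) := by
  rw [Matrix.mulVec_neg, innovCostate, mulVec_inv_mulVec (hR _ (by omega) hk).isUnit, neg_sub,
    M.fused_eq_augment hP0 hQ hR _ hk]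

/-- Summation by parts: the adjoint recursion moves `F` from the costate onto `d`, so consecutive
pairings of costate and variation differ by one dynamics term and one observation term. -/
theorem stationarity_aux (hP0 : M.P0.PosSemidef) (hQ : ∀ k, k < M.N → (M.Q k).PosSemidef)
    (hR : ∀ k, 1 ≤ k → k ≤ M.N → (M.R k).PosDef) (d : ℕ → Fin M.n → ℝ) (k : ℕ) (hk : k ≤ M.N) :
    M.costate 0 ⬝ᵥ M.augment d 0
      + ∑ j ∈ Finset.range k,
          (M.updCostate (j + 1) ∘ Sum.inl) ⬝ᵥ (d (j + 1) - M.F j *ᵥ d j)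
      + ∑ j ∈ Finset.range k,
          (-M.innovCostate (j + 1)) ⬝ᵥ (M.Haug (j + 1) *ᵥ M.augment d (j + 1))
      = M.costate k ⬝ᵥ M.augment d k := by
  induction k with
  | zero => simp
  | succ k ih =>
    have h : M.costate k ⬝ᵥ M.augment d k = M.costate (k + 1) ⬝ᵥ M.augment d (k + 1)
        + M.innovCostate (k + 1) ⬝ᵥ (M.Haug (k + 1) *ᵥ M.augment d (k + 1))
        - (M.updCostate (k + 1) ∘ Sum.inl) ⬝ᵥ (d (k + 1) - M.F k *ᵥ d k) := by
      rw [(M.fused_succ hP0 hQ hR hk).2, Matrix.mulVec_transpose, ← Matrix.dotProduct_mulVec,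
        Faug_mulVec_augment, dotProduct_sub]
      congr 1
      · rw [updCostate, add_dotProduct, Matrix.mulVec_transpose, ← Matrix.dotProduct_mulVec]
      · simp [dotProduct]
    rw [Finset.sum_range_succ, Finset.sum_range_succ, neg_dotProduct]
    linarith [ih (by omega)]

/-- The gradient of the cost vanishes at the smoothed trajectory. -/
theorem stationarity (hP0 : M.P0.PosSemidef) (hQ : ∀ k, k < M.N → (M.Q k).PosSemidef)
    (hR : ∀ k, 1 ≤ k → k ≤ M.N → (M.R k).PosDef) (d : ℕ → Fin M.n → ℝ) :
    (M.costate 0 ∘ Sum.inl) ⬝ᵥ d 0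
      + ∑ j : Fin M.N, (M.updCostate (j + 1) ∘ Sum.inl) ⬝ᵥ (d (j + 1) - M.F j *ᵥ d j)
      + ∑ j : Fin M.N, (-M.innovCostate (j + 1)) ⬝ᵥ (M.Haug (j + 1) *ᵥ M.augment d (j + 1))
      = 0 := by
  have h := M.stationarity_aux hP0 hQ hR d M.N le_rfl
  rw [← Fin.sum_univ_eq_sum_range
      (fun j => (M.updCostate (j + 1) ∘ Sum.inl) ⬝ᵥ (d (j + 1) - M.F j *ᵥ d j)),
    ← Fin.sum_univ_eq_sum_range
      (fun j => (-M.innovCostate (j + 1)) ⬝ᵥ (M.Haug (j + 1) *ᵥ M.augment d (j + 1)))] at h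
  have h0 : M.costate 0 ⬝ᵥ M.augment d 0 = (M.costate 0 ∘ Sum.inl) ⬝ᵥ d 0 := by
    have : IsEmpty {i // i ∈ M.clones 0} := ⟨fun i => Nat.not_lt_zero _ (M.lt_of_mem_clones i.2)⟩
    simp [dotProduct, augment]
  -- Terminal condition: no information comes from beyond time `N`.
  have hN : M.costate M.N = 0 := by simp [costate, M.backward_of_le le_rfl]
  rwa [h0, hN, zero_dotProduct] at h

/-! ### Optimality -/

theorem exists_eq_restrict (χ : M.Trajectory) : ∃ x : ℕ → Fin M.n → ℝ,
    χ = fun k : Fin (M.N + 1) => x k :=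
  ⟨fun k => if h : k < M.N + 1 then χ ⟨k, h⟩ else 0, by
    funext k
    simp only [k.2, dif_pos]⟩

theorem obsResidual_restrict (x : ℕ → Fin M.n → ℝ) (k : Fin M.N) :
    M.obsResidual (fun k : Fin (M.N + 1) => x k) k
      = M.Haug (k + 1) *ᵥ M.augment x (k + 1) - M.z (k + 1) := by
  rw [M.Haug_mulVec_augment x (by omega)]
  rfl

theorem augment_sub (x y : ℕ → Fin M.n → ℝ) (k : ℕ) :
    M.augment (x - y) k = M.augment x k - M.augment y k := by
  funext r
  rcases r with a | c <;> rfl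

/-- The value of the extended cost at the smoothed trajectory. -/
def minCost : ℝ :=
  (M.costate 0 ∘ Sum.inl) ⬝ᵥ (M.P0 *ᵥ (M.costate 0 ∘ Sum.inl))
    + ∑ k : Fin M.N, (M.updCostate (k + 1) ∘ Sum.inl) ⬝ᵥ
        (M.Q k *ᵥ (M.updCostate (k + 1) ∘ Sum.inl))
    + ∑ k : Fin M.N, (-M.innovCostate (k + 1)) ⬝ᵥ (M.R (k + 1) *ᵥ (-M.innovCostate (k + 1)))

theorem costExt_smoothed (hP0 : M.P0.PosSemidef) (hQ : ∀ k, k < M.N → (M.Q k).PosSemidef)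
    (hR : ∀ k, 1 ≤ k → k ≤ M.N → (M.R k).PosDef) :
    0 ≤ M.minCost ∧
      M.costExt (fun k : Fin (M.N + 1) => M.smoothed k) = ENNReal.ofReal M.minCost := by
  have hA : 0 ≤ (M.costate 0 ∘ Sum.inl) ⬝ᵥ (M.P0 *ᵥ (M.costate 0 ∘ Sum.inl)) := by
    simpa using hP0.dotProduct_mulVec_nonneg
      (M.costate 0 ∘ Sum.inl)
  have hB (k : Fin M.N) : 0 ≤ (M.updCostate (k + 1) ∘ Sum.inl) ⬝ᵥ
      (M.Q k *ᵥ (M.updCostate (k + 1) ∘ Sum.inl)) := by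
    simpa using (hQ k k.2).dotProduct_mulVec_nonneg (M.updCostate (k + 1) ∘ Sum.inl)
  have hC (k : Fin M.N) : 0 ≤ (-M.innovCostate (k + 1)) ⬝ᵥ
      (M.R (k + 1) *ᵥ (-M.innovCostate (k + 1))) := by
    simpa only [star_trivial] using
      (hR (k + 1) (by omega) (by omega)).posSemidef.dotProduct_mulVec_nonneg (-M.innovCostate (k + 1))
  refine ⟨add_nonneg (add_nonneg hA (Finset.sum_nonneg fun k _ => hB k))
    (Finset.sum_nonneg fun k _ => hC k), ?_⟩
  rw [minCost, ENNReal.ofReal_add (add_nonneg hA (Finset.sum_nonneg fun k _ => hB k))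
      (Finset.sum_nonneg fun k _ => hC k),
    ENNReal.ofReal_add hA (Finset.sum_nonneg fun k _ => hB k),
    ENNReal.ofReal_sum_of_nonneg fun k _ => hB k, ENNReal.ofReal_sum_of_nonneg fun k _ => hC k,
    costExt]
  congr 1
  · congr 1
    · rw [← mahalanobisSqExt_mulVec hP0, ← M.smoothed_zero hP0 hQ hR]
      rfl
    · refine Finset.sum_congr rfl fun k _ => ?_
      rw [← mahalanobisSqExt_mulVec (hQ k k.2), ← M.smoothed_succ hP0 hQ hR k.2]
      rfl
  · refine Finset.sum_congr rfl fun k _ => ?_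
    rw [← mahalanobisSqExt_mulVec (hR (k + 1) (by omega) (by omega)).posSemidef,
      ← M.smoothed_obs hP0 hQ hR k.2, obsResidual_restrict]

theorem costExt_smoothed_lt (hP0 : M.P0.PosSemidef) (hQ : ∀ k, k < M.N → (M.Q k).PosSemidef)
    (hR : ∀ k, 1 ≤ k → k ≤ M.N → (M.R k).PosDef) (χ : M.Trajectory)
    (hχ : χ ≠ fun k : Fin (M.N + 1) => M.smoothed k) :
    M.costExt (fun k : Fin (M.N + 1) => M.smoothed k) < M.costExt χ := by
  by_contra hle
  refine hχ ?_
  obtain ⟨hnn, hval⟩ := M.costExt_smoothed hP0 hQ hR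
  rw [not_lt, hval] at hle
  have hfin : M.costExt χ ≠ ⊤ := ne_top_of_le_ne_top ENNReal.ofReal_ne_top hle
  obtain ⟨x, rfl⟩ := M.exists_eq_restrict χ
  have hx : M.costExt (fun k : Fin (M.N + 1) => x k) = mahalanobisSqExt M.P0 (x 0 - M.z0)
    + ∑ k : Fin M.N, mahalanobisSqExt (M.Q k) (M.dynResidual (fun k : Fin (M.N + 1) => x k) k)
    + ∑ k : Fin M.N, mahalanobisSqExt (M.R (k + 1))
        (M.obsResidual (fun k : Fin (M.N + 1) => x k) k) := rfl
  rw [hx] at hfin hle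
  obtain ⟨hf, hfR'⟩ := ENNReal.add_ne_top.1 hfin
  obtain ⟨hf0, hfQ'⟩ := ENNReal.add_ne_top.1 hf
  have hfR := ENNReal.sum_ne_top.1 hfR'
  have hfQ := ENNReal.sum_ne_top.1 hfQ'
  have hle' := ENNReal.toReal_mono ENNReal.ofReal_ne_top hle
  rw [ENNReal.toReal_ofReal hnn, ENNReal.toReal_add hf hfR', ENNReal.toReal_add hf0 hfQ',
    ENNReal.toReal_sum hfQ, ENNReal.toReal_sum hfR, minCost] at hle'
  have hR' (k : Fin M.N) : (M.R (k + 1)).PosSemidef := (hR _ (by omega) (by omega)).posSemidef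
  have t0 := mahalanobisSqExt_tangent hP0 (M.costate 0 ∘ Sum.inl) _ hf0
  have tQ (k : Fin M.N) := mahalanobisSqExt_tangent (hQ k k.2)
    (M.updCostate (k + 1) ∘ Sum.inl) _ (hfQ k (Finset.mem_univ _))
  have tR (k : Fin M.N) := mahalanobisSqExt_tangent (hR' k)
    (-M.innovCostate (k + 1)) _ (hfR k (Finset.mem_univ _))
  have e0 : x 0 - M.z0 - M.P0 *ᵥ (M.costate 0 ∘ Sum.inl) = (x - M.smoothed) 0 := by
    rw [← M.smoothed_zero hP0 hQ hR, Pi.sub_apply]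
    abel
  have eQ (k : Fin M.N) : M.dynResidual (fun k : Fin (M.N + 1) => x k) k
        - M.Q k *ᵥ (M.updCostate (k + 1) ∘ Sum.inl)
      = (x - M.smoothed) (k + 1) - M.F k *ᵥ (x - M.smoothed) k := by
    rw [← M.smoothed_succ hP0 hQ hR k.2, Pi.sub_apply, Pi.sub_apply, Matrix.mulVec_sub]
    change x (k + 1) - M.F k *ᵥ x k - M.u k - _ = _
    abel
  have eR (k : Fin M.N) : M.obsResidual (fun k : Fin (M.N + 1) => x k) k
        - M.R (k + 1) *ᵥ (-M.innovCostate (k + 1))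
      = M.Haug (k + 1) *ᵥ M.augment (x - M.smoothed) (k + 1) := by
    rw [← M.smoothed_obs hP0 hQ hR k.2, obsResidual_restrict, augment_sub, Matrix.mulVec_sub]
    abel
  have hst := M.stationarity hP0 hQ hR (x - M.smoothed)
  -- The linear terms of the tangent bounds now sum to zero, so one strict bound would contradict
  -- `hle'`.
  simp only [← e0, ← eQ, ← eR] at hst
  have s0 := t0.1
  have sQ := Finset.sum_le_sum fun k (_ : k ∈ Finset.univ) => (tQ k).1
  have sR := Finset.sum_le_sum fun k (_ : k ∈ Finset.univ) => (tR k).1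
  simp only [Finset.sum_add_distrib, ← Finset.mul_sum] at sQ sR
  have d0 : (x - M.smoothed) 0 = 0 := by
    by_contra h
    have := t0.2 (sub_ne_zero.1 (e0 ▸ h))
    linarith
  have dQ (k : Fin M.N) : (x - M.smoothed) (k + 1) - M.F k *ᵥ (x - M.smoothed) k = 0 := by
    by_contra h
    have := Finset.sum_lt_sum (fun k (_ : k ∈ Finset.univ) => (tQ k).1)
      ⟨k, Finset.mem_univ _, (tQ k).2 (sub_ne_zero.1 (eQ k ▸ h))⟩
    simp only [Finset.sum_add_distrib, ← Finset.mul_sum] at this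
    linarith
  -- The difference starts at zero and obeys the homogeneous dynamics; uniqueness needs no
  -- observations.
  have hd (k : ℕ) (hk : k ≤ M.N) : (x - M.smoothed) k = 0 := by
    induction k with
    | zero => exact d0
    | succ k ih => simpa only [ih (by omega), Matrix.mulVec_zero, sub_zero] using dQ ⟨k, hk⟩
  funext k
  exact sub_eq_zero.1 (hd k (by omega))

theorem costExt_eq_ofReal_cost (hP0 : M.P0.PosDef) (hQ : ∀ k, k < M.N → (M.Q k).PosDef)
    (hR : ∀ k, 1 ≤ k → k ≤ M.N → (M.R k).PosDef) (χ : M.Trajectory) :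
    M.costExt χ = ENNReal.ofReal (M.cost χ) := by
  have hB (k : Fin M.N) := mahalanobisSqExt_eq_ofReal (hQ k k.2) (M.dynResidual χ k)
  have hC (k : Fin M.N) :=
    mahalanobisSqExt_eq_ofReal (hR (k + 1) (by omega) (by omega)) (M.obsResidual χ k)
  have hA := mahalanobisSqExt_eq_ofReal hP0 (χ 0 - M.z0)
  rw [cost, ENNReal.ofReal_add (add_nonneg hA.2 (Finset.sum_nonneg fun k _ => (hB k).2))
      (Finset.sum_nonneg fun k _ => (hC k).2),
    ENNReal.ofReal_add hA.2 (Finset.sum_nonneg fun k _ => (hB k).2),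
    ENNReal.ofReal_sum_of_nonneg fun k _ => (hB k).2,
    ENNReal.ofReal_sum_of_nonneg fun k _ => (hC k).2, costExt, hA.1]
  simp only [fun k => (hB k).1, fun k => (hC k).1]

end SmoothingProblem

end

theorem mainTheorem2 (M : SmoothingProblem)
    (hP0 : M.P0.PosSemidef)
    (hQ : ∀ k, k < M.N → (M.Q k).PosSemidef)
    (hR : ∀ k, 1 ≤ k → k ≤ M.N → (M.R k).PosDef) :
    -- every matrix that the algorithm inverts is invertible, even if `P0` and `Q` are singular
    (∀ k, k < M.N →
      IsUnit (M.innovCov (k + 1) (M.predCov k (M.forward k).2)) ∧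
      IsUnit (M.R (k + 1)) ∧
      IsUnit (1 + M.updatedJ (k + 1) * M.Qaug k)) ∧
    (∀ k, k ≤ M.N → IsUnit (1 + (M.forward k).2 * (M.backward k).2)) ∧
    -- the backward pass merges the clone `k` with the current state by adding blocks
    (∀ k, k < M.N → ∀ (h : k ∈ M.clones (k + 1)) (a b : Fin M.n),
      (M.backward k).1 (Sum.inl a) =
        M.unmergedY k (Sum.inl a) + M.unmergedY k (Sum.inr (⟨k, h⟩, a)) ∧
      (M.backward k).2 (Sum.inl a) (Sum.inl b) =
        M.unmergedJ k (Sum.inl a) (Sum.inl b) +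
        M.unmergedJ k (Sum.inl a) (Sum.inr (⟨k, h⟩, b)) +
        M.unmergedJ k (Sum.inr (⟨k, h⟩, a)) (Sum.inl b) +
        M.unmergedJ k (Sum.inr (⟨k, h⟩, a)) (Sum.inr (⟨k, h⟩, b))) ∧
    -- and pads with zeros the clones that the forward pass discards
    (∀ k, k < M.N → ∀ i : {i // i ∈ M.clones k}, i.1 ∉ M.clones (k + 1) → ∀ a : Fin M.n,
      (M.backward k).1 (Sum.inr (i, a)) = 0 ∧
      ∀ c, (M.backward k).2 (Sum.inr (i, a)) c = 0 ∧ (M.backward k).2 c (Sum.inr (i, a)) = 0) ∧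
    -- for invertible covariances, the output is the unique minimizer of the cost
    (M.P0.PosDef → (∀ k, k < M.N → (M.Q k).PosDef) →
      ∀ χ : M.Trajectory, χ ≠ M.scbifm → M.cost M.scbifm < M.cost χ) ∧
    -- for possibly singular covariances, the same holds with their null directions as constraints
    (M.costExt M.scbifm ≠ ⊤ ∧
      ∀ χ : M.Trajectory, χ ≠ M.scbifm → M.costExt M.scbifm < M.costExt χ) := by
  refine ⟨fun k hk => ⟨M.isUnit_innovCov hP0 hQ hR hk, (hR _ (by omega) hk).isUnit,
    M.isUnit_updatedJ hQ hR hk⟩, fun k hk => M.isUnit_fusion hP0 hQ hR hk, ?_, ?_, ?_, ?_, ?_⟩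
  · intro k hk h a b
    refine ⟨?_, ?_⟩
    · rw [M.backward_vec_eq hk, M.sum_source_inl k h]
    · rw [M.backward_mat_eq hk, M.sum_source_inl k h, M.sum_source_inl k h,
        M.sum_source_inl k h]
      ring
  · intro k hk i hi a
    have hs := M.source_ne_inr k i hi a
    refine ⟨?_, fun c => ⟨?_, ?_⟩⟩
    · simp only [M.backward_vec_eq hk, hs, if_false, Finset.sum_const_zero]
    · simp only [M.backward_mat_eq hk, hs, if_false, Finset.sum_const_zero]
    · simp only [M.backward_mat_eq hk, hs, if_false, Finset.sum_const_zero, ite_self]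
  · intro hP0' hQ' χ hχ
    have := M.costExt_smoothed_lt hP0 hQ hR χ hχ
    rw [M.costExt_eq_ofReal_cost hP0' hQ' hR, M.costExt_eq_ofReal_cost hP0' hQ' hR] at this
    exact (ENNReal.ofReal_lt_ofReal_iff'.1 this).1
  · exact (M.costExt_smoothed hP0 hQ hR).2 ▸ ENNReal.ofReal_ne_top
  · exact M.costExt_smoothed_lt hP0 hQ hR
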